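/- Let $\mathbb B=\{0,1\}$. A prefix machine is a partial computable function $M(p,y)$ of a program $p\in\mathbb B^*$ and an input $y\in\mathbb B^*$, with values in $\mathbb B^*$, such that for each fixed $y$ the set of programs on which $M(\cdot,y)$ halts is prefix-free. Fix an optimal prefix machine $U$, i.e. a prefix machine such that for every prefix machine $M$ there is a constant $k$ such that whenever $M(p,y)=x$ there is a program $q$ with $U(q,y)=x$ and $\ell(q)\le\ell(p)+k$. Let $K(x|y):=\min\{\ell(p):U(p,y)=x\}$ be the conditional prefix Kolmogorov complexity. Fix $c\ge 0$, and let $d_K(x,y):=\max\{K(x|y),K(y|x)\}+c$ for $x\ne y$, and $d_K(x,x):=0$. A metric space $(\mathcal V,d)$ sequence-embeds into $(\mathbb B^*,d_K)$ if there are a map $\varphi:\mathcal V\to\mathbb B^\infty$, a function $f:\mathbb N\times\mathcal V\to\mathbb N$ that is strictly increasing and at most polynomially growing in its first argument $s$, and constants $a,b$ such that $$\bigl|d_K\bigl(\varphi(v)_{1:f(s,v)},\,\varphi(v')_{1:f(s,v')}\bigr)-s\cdot d(v,v')\bigr|\le a\log_2 s+b\qquad\text{for all } s\ge 1 \text{ and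 all } v,v'\in\mathcal V,$$ where $w_{1:n}$ denotes the initial segment of length $n$ of the sequence $w$. **Theorem.** Every finite subset of a real inner product space with the metric $\|v-v'\|$ (in particular, every finite subset of a Euclidean space $\mathbb R^n$, of $\ell_2$ or of a Hilbert space) sequence-embeds into $(\mathbb B^*,d_K)$. The same holds for the distance $d_K^+$ in which the maximum is replaced by the average $\tfrac12[K(x|y)+K(y|x)]$. -/

import Mathlib

namespace AlgDist

/-- Finite binary strings. -/
abbrev BinStr : Type := List Bool

/-- A (conditional) prefix machine: a partial computable function `M p y` of a program `p` and
an input `y` such that, for every fixed input `y`, the set of programs on which the machine halts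
is prefix-free. -/
structure IsPrefixMachine (M : BinStr → BinStr →. BinStr) : Prop where
  computable : Partrec₂ M
  prefixFree : ∀ y p q : BinStr, (M p y).Dom → (M q y).Dom → p <+: q → p = q

/-- An optimal (additively universal) prefix machine: a prefix machine that simulates every prefix
machine with at most a constant increase in program length. -/
structure IsOptimalPrefixMachine (U : BinStr → BinStr →. BinStr) : Prop where
  isPrefixMachine : IsPrefixMachine U
  optimal : ∀ M : BinStr → BinStr →. BinStr, IsPrefixMachine M →
    ∃ k : ℕ, ∀ p y x : BinStr, x ∈ M p y → ∃ q : BinStr, x ∈ U q y ∧ q.length ≤ p.length + k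

/-- Conditional prefix Kolmogorov complexity `K(x|y)` relative to `U`: the length of a shortest
program that outputs `x` on input `y`.  (For optimal `U` such a program always exists, see
`IsOptimalPrefixMachine.exists_program`, so that the infimum is a minimum.) -/
noncomputable def condK (U : BinStr → BinStr →. BinStr) (x y : BinStr) : ℕ :=
  sInf {n : ℕ | ∃ p : BinStr, p.length = n ∧ x ∈ U p y}

/-- For an optimal prefix machine, every string has a program given any input. -/
theorem IsOptimalPrefixMachine.exists_program {U : BinStr → BinStr →. BinStr}
    (hU : IsOptimalPrefixMachine U) (x y : BinStr) : ∃ p : BinStr, x ∈ U p y := by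
  have hM : IsPrefixMachine (fun p _ => ((if p = [] then some x else none : Option BinStr) :
      Part BinStr)) := by
    refine ⟨?_, ?_⟩
    · refine Computable.ofOption (Primrec.to_comp ?_)
      exact Primrec.ite (Primrec.eq.comp Primrec.fst (Primrec.const []))
        (Primrec.const _) (Primrec.const _)
    · intro y p q hp hq _
      have h : ∀ r : BinStr, ((if r = [] then some x else none : Option BinStr) :
          Part BinStr).Dom → r = [] := by
        intro r hr
        by_contra h
        simp [h] at hr
      rw [h p hp, h q hq]
  obtain ⟨k, hk⟩ := hU.optimal _ hM
  obtain ⟨q, hq, _⟩ := hk [] y x (by simp)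
  exact ⟨q, hq⟩

/-- The complexity distance `d_K(x,y) = max {K(x|y), K(y|x)} + c` for `x ≠ y`,
and `d_K(x,x) = 0`. -/
noncomputable def dK (U : BinStr → BinStr →. BinStr) (c : ℝ) (x y : BinStr) : ℝ :=
  if x = y then 0 else max (condK U x y : ℝ) (condK U y x : ℝ) + c

/-- The variant `d_K⁺` of `d_K` with the average in place of the maximum. -/
noncomputable def dKAvg (U : BinStr → BinStr →. BinStr) (c : ℝ) (x y : BinStr) : ℝ :=
  if x = y then 0 else ((condK U x y : ℝ) + (condK U y x : ℝ)) / 2 + c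

/-- The initial segment of length `n` of an infinite binary sequence. -/
def initSeg (w : ℕ → Bool) (n : ℕ) : BinStr := List.ofFn fun i : Fin n => w i

/-- The metric space `V` sequence-embeds into binary strings with distance `δ`: there are infinite
sequences `φ v` and lengths `f s v`, increasing and at most polynomially growing in `s`,
such that the distance `δ` between the initial segments of `φ v`, `φ v'` of lengths `f s v`,
`f s v'` equals `s * dist v v'` up to an additive error `a * log s + b`, with constants `a`, `b`
independent of `s`, `v`, `v'`. -/
def SequenceEmbeds (V : Type*) [MetricSpace V] (δ : BinStr → BinStr → ℝ) : Prop :=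
  ∃ (φ : V → ℕ → Bool) (f : ℕ → V → ℕ),
    (∀ v : V, StrictMono fun s : ℕ => f s v) ∧
    (∃ C k : ℕ, ∀ (v : V) (s : ℕ), 1 ≤ s → f s v ≤ C * s ^ k) ∧
    ∃ a b : ℝ, ∀ (s : ℕ) (v v' : V), 1 ≤ s →
      |δ (initSeg (φ v) (f s v)) (initSeg (φ v') (f s v')) - (s : ℝ) * dist v v'|
        ≤ a * Real.logb 2 (s : ℝ) + b

end AlgDist

/-! The proof turns the points into partial views of one random sequence. By integral geometry,
finitely many points of a Euclidean space are `ℓ₁`-embeddable: up to a constant, `‖x i - x j‖` is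
the measure of the half-spaces that contain `x i` but not `x j`. This gives weights on cuts `S` such
that the oriented sum over `i ∈ S`, `j ∉ S` is the distance (`exists_cut_weights`).

Each cut is given its own set of positions, with density proportional to its weight, and point `u`
sees the bits of a sequence `ω` exactly at the positions of the cuts containing `u`. Describing the
view of `u` given that of `v` then amounts to supplying the bits new to `v`, and their number grows
like `s` times the distance.

The upper bound (`exists_condK_turnMask_le`) needs the position sets to be computable from few bits,
although the weights are arbitrary reals. Distributing the binary digits of a weight along the ruler
sequence achieves this: logarithmically many digits fix an initial segment, and the density error is
logarithmic too. The lower bound (`exists_incompressible`) holds for almost every `ω`, by counting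
and Borel–Cantelli. Since the cuts are oriented, each of `K(x|y)` and `K(y|x)` satisfies the
estimate, hence so do their maximum and their average. -/

namespace AlgDist

open MeasureTheory

/-! ### Cut weights from random half-spaces -/

section CutWeights

variable {W : Type*} [NormedAddCommGroup W] [InnerProductSpace ℝ W] [FiniteDimensional ℝ W]
  [MeasurableSpace W] [BorelSpace W]

/-- The integral over the unit ball of the positive part of the linear form `⟪·, u⟫`. -/
noncomputable def ballWidth (u : W) : ENNReal :=
  ∫⁻ g in Metric.ball (0 : W) 1, ENNReal.ofReal (inner ℝ g u)

theorem measurable_ofReal_inner (u : W) :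
    Measurable fun g : W => ENNReal.ofReal (inner ℝ g u) := by
  fun_prop

theorem ballWidth_map (φ : W ≃ₗᵢ[ℝ] W) (u : W) : ballWidth (φ u) = ballWidth u := by
  have h := φ.measurePreserving.setLIntegral_comp_preimage
    (Metric.isOpen_ball (x := (0 : W)) (ε := 1)).measurableSet (measurable_ofReal_inner (φ u))
  rw [φ.preimage_ball] at h
  simpa [ballWidth] using h.symm

/-- The reflection in the hyperplane orthogonal to `u - v` exchanges `u` and `v` and preserves the
ball. -/
theorem ballWidth_congr_norm {u v : W} (h : ‖u‖ = ‖v‖) : ballWidth u = ballWidth v := by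
  have := ballWidth_map (Submodule.reflection (ℝ ∙ (u - v))ᗮ) u
  rwa [Submodule.reflection_sub h, eq_comm] at this

theorem ballWidth_smul {r : ℝ} (hr : 0 ≤ r) (u : W) :
    ballWidth (r • u) = ENNReal.ofReal r * ballWidth u := by
  unfold ballWidth
  rw [← lintegral_const_mul _ (measurable_ofReal_inner u)]
  simp only [inner_smul_right, ENNReal.ofReal_mul hr]

theorem ballWidth_ne_top (u : W) : ballWidth u ≠ ⊤ := by
  refine ne_top_of_le_ne_top (b := ENNReal.ofReal ‖u‖ * volume (Metric.ball (0 : W) 1))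
    (ENNReal.mul_ne_top ENNReal.ofReal_ne_top measure_ball_lt_top.ne) ?_
  refine (setLIntegral_mono measurable_const fun g hg => ?_).trans_eq
    (setLIntegral_const _ _)
  refine ENNReal.ofReal_le_ofReal ((real_inner_le_norm g u).trans ?_)
  have : ‖g‖ ≤ 1 := by simpa using (mem_ball_zero_iff.1 hg).le
  exact mul_le_of_le_one_left (norm_nonneg u) this

theorem ballWidth_ne_zero {u : W} (hu : u ≠ 0) : ballWidth u ≠ 0 := by
  intro h
  have hopen : IsOpen (Metric.ball (0 : W) 1 ∩ {g | 0 < inner ℝ g u}) :=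
    Metric.isOpen_ball.inter (isOpen_lt continuous_const (by fun_prop))
  have hn : 0 < ‖u‖ := norm_pos_iff.2 hu
  have hne : (Metric.ball (0 : W) 1 ∩ {g | 0 < inner ℝ g u}).Nonempty := by
    refine ⟨(2 * ‖u‖)⁻¹ • u, ?_, ?_⟩
    · rw [mem_ball_zero_iff, norm_smul, Real.norm_of_nonneg (by positivity)]
      field_simp
      norm_num
    · simp only [Set.mem_ofPred_eq, inner_smul_left, real_inner_self_eq_norm_sq]
      simp
      positivity
  have hpos := hopen.measure_pos (volume : Measure W) hne
  rw [ballWidth, lintegral_eq_zero_iff (measurable_ofReal_inner u)] at h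
  rw [Filter.EventuallyEq, ae_iff, Measure.restrict_apply'
    Metric.isOpen_ball.measurableSet] at h
  refine hpos.ne' (measure_mono_null ?_ h)
  rintro g ⟨hg, hg'⟩
  exact ⟨by simpa using hg', hg⟩

theorem exists_ballWidth_eq :
    ∃ C : ENNReal, C ≠ 0 ∧ C ≠ ⊤ ∧ ∀ u : W, ballWidth u = ENNReal.ofReal ‖u‖ * C := by
  by_cases h : ∃ e : W, e ≠ 0
  · obtain ⟨e, he⟩ := h
    have hn : 0 < ‖e‖ := norm_pos_iff.2 he
    have he' : ‖e‖⁻¹ • e ≠ 0 := smul_ne_zero (inv_ne_zero hn.ne') he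
    refine ⟨ballWidth (‖e‖⁻¹ • e), ballWidth_ne_zero he', ballWidth_ne_top _, fun u => ?_⟩
    rw [← ballWidth_smul (norm_nonneg u)]
    refine ballWidth_congr_norm ?_
    rw [norm_smul, norm_smul, norm_inv, norm_norm, norm_norm, inv_mul_cancel₀ hn.ne', mul_one]
  · push Not at h
    refine ⟨1, one_ne_zero, ENNReal.one_ne_top, fun u => ?_⟩
    simp [h u, ballWidth]

/-- For a fixed normal `g`, the separating thresholds form an interval whose length is the positive
part of `⟪g, u - v⟫`; integrate over `g`. -/
theorem volume_halfspaces_between (u v : W) :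
    ((volume.restrict (Metric.ball (0 : W) 1)).prod volume)
      {z : W × ℝ | z.2 < inner ℝ z.1 u ∧ ¬ z.2 < inner ℝ z.1 v} = ballWidth (u - v) := by
  rw [Measure.prod_apply, ballWidth]
  · refine lintegral_congr fun g => ?_
    have : Prod.mk g ⁻¹' {z : W × ℝ | z.2 < inner ℝ z.1 u ∧ ¬ z.2 < inner ℝ z.1 v}
        = Set.Ico (inner ℝ g v) (inner ℝ g u) := by
      ext t
      simp [and_comm]
    rw [this, Real.volume_Ico, inner_sub_right]
  · have hm (w : W) : MeasurableSet {z : W × ℝ | z.2 < inner ℝ z.1 w} :=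
      measurableSet_lt (by fun_prop) (by fun_prop)
    exact (hm u).inter (hm v).compl

end CutWeights

/-- A finite family of points of a Euclidean space is `ℓ₁`-embeddable: its distances are
nonnegative combinations of (oriented) cut distances. -/
theorem exists_cut_weights {W : Type*} [NormedAddCommGroup W] [InnerProductSpace ℝ W]
    [FiniteDimensional ℝ W] {ι : Type*} [Fintype ι] [DecidableEq ι] (x : ι → W) :
    ∃ lam : Finset ι → ℝ, (∀ S, 0 ≤ lam S) ∧
      ∀ i j, ∑ S with i ∈ S ∧ j ∉ S, lam S = ‖x i - x j‖ := by
  let _ : MeasurableSpace W := borel W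
  have _ : BorelSpace W := ⟨rfl⟩
  obtain ⟨C, hC0, hCt, hC⟩ := exists_ballWidth_eq (W := W)
  set ν := (volume.restrict (Metric.ball (0 : W) 1)).prod (volume : Measure ℝ)
  let T : W × ℝ → Finset ι := fun z => Finset.univ.filter fun i => z.2 < inner ℝ z.1 (x i)
  have hTmeas : ∀ S, MeasurableSet (T ⁻¹' {S}) := by
    intro S
    have : T ⁻¹' {S} = ⋂ i, {z : W × ℝ | z.2 < inner ℝ z.1 (x i) ↔ i ∈ S} := by
      ext z
      simp [T, Finset.ext_iff]
    rw [this]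
    refine MeasurableSet.iInter fun i => ?_
    have hm : MeasurableSet {z : W × ℝ | z.2 < inner ℝ z.1 (x i)} :=
      measurableSet_lt (by fun_prop) (by fun_prop)
    by_cases hi : i ∈ S
    · simpa [hi] using hm
    · simp only [hi, iff_false]
      exact hm.compl
  -- The cuts `∅` and `univ` may have infinite measure, which `toReal` sends to `0`; they separate
  -- no pair, so their weights never enter the sums.
  refine ⟨fun S => (ν (T ⁻¹' {S}) / C).toReal, fun S => ENNReal.toReal_nonneg, fun i j => ?_⟩
  have hsum : ∑ S with i ∈ S ∧ j ∉ S, ν (T ⁻¹' {S}) = ENNReal.ofReal ‖x i - x j‖ * C := by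
    rw [← hC, ← volume_halfspaces_between, sum_measure_preimage_singleton _ fun S _ => hTmeas S]
    congr 1
    ext z
    simp [T]
  have hfin : ∀ S ∈ Finset.univ.filter (fun S : Finset ι => i ∈ S ∧ j ∉ S),
      ν (T ⁻¹' {S}) / C ≠ ⊤ := by
    intro S hS
    have h1 : ν (T ⁻¹' {S}) ≤ ENNReal.ofReal ‖x i - x j‖ * C :=
      hsum ▸ Finset.single_le_sum (f := fun S => ν (T ⁻¹' {S})) (fun _ _ => zero_le) hS
    exact ENNReal.div_ne_top
      (ne_top_of_le_ne_top (ENNReal.mul_ne_top ENNReal.ofReal_ne_top hCt) h1) hC0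
  rw [← ENNReal.toReal_sum hfin]
  simp only [div_eq_mul_inv]
  rw [← Finset.sum_mul, hsum, mul_assoc, ENNReal.mul_inv_cancel hC0 hCt, mul_one,
    ENNReal.toReal_ofReal (norm_nonneg _)]

/-! ### Position sets of prescribed density -/

/-- The binary digits of a real number in the unit interval. -/
noncomputable def digit : ℕ → ℝ → Bool
  | 0, a => decide (1 / 2 ≤ a)
  | k + 1, a => digit k (2 * a - if 1 / 2 ≤ a then 1 else 0)

/-- The ruler sequence: the exponent of `2` in `t + 1`. -/
def ruler (t : ℕ) : ℕ := if t % 2 = 0 then 0 else ruler (t / 2) + 1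

theorem ruler_even (u : ℕ) : ruler (u * 2) = 0 := by
  rw [ruler, if_pos (by omega)]

theorem ruler_odd (u : ℕ) : ruler (u * 2 + 1) = ruler u + 1 := by
  rw [ruler, if_neg (by omega), show (u * 2 + 1) / 2 = u by omega]

theorem ruler_lt {t L : ℕ} (h : t + 1 < 2 ^ L) : ruler t < L := by
  induction L generalizing t with
  | zero => simp at h
  | succ L ih =>
    rw [ruler]
    split_ifs
    · omega
    · have := ih (t := t / 2) (by rw [pow_succ] at h; omega)
      omega

theorem primrec_ruler : Primrec ruler := by
  have h : Primrec₂ fun (_ : Unit) (n : ℕ) => ruler n := by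
    refine Primrec.nat_strong_rec _ (g := fun _ l => some (if l.length % 2 = 0 then 0 else
      l.getD (l.length / 2) 0 + 1)) ?_ fun _ n => ?_
    · have hl : Primrec fun z : Unit × List ℕ => z.2.length := Primrec.list_length.comp Primrec.snd
      refine Primrec.option_some.comp (Primrec.ite
        (Primrec.eq.comp (Primrec.nat_mod.comp hl (Primrec.const 2)) (Primrec.const 0))
        (Primrec.const 0) (Primrec.succ.comp ((Primrec.list_getD 0).comp Primrec.snd
          (Primrec.nat_div.comp hl (Primrec.const 2)))))
    · rw [ruler]
      simp only [List.length_map, List.length_range, Option.some.injEq]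
      split_ifs with h0
      · rfl
      · have : n / 2 < n := by omega
        simp [List.getD_eq_getElem?_getD, this]
  exact h.comp (Primrec.const ()) Primrec.id

theorem sum_range_mul_blocks {M : Type*} [AddCommMonoid M] (f : ℕ → M) (T J : ℕ) :
    ∑ i ∈ Finset.range (T * J), f i
      = ∑ t ∈ Finset.range T, ∑ j ∈ Finset.range J, f (t * J + j) := by
  induction T with
  | zero => simp
  | succ T ih => rw [add_mul, one_mul, Finset.sum_range_add, ih, Finset.sum_range_succ]

/-- The times selected by the digits of `a` along the ruler sequence have density `a`, with a
logarithmic error. -/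
theorem abs_sum_digit_ruler_sub_le (L : ℕ) {T : ℕ} (hT : T < 2 ^ L) {a : ℝ} (ha0 : 0 ≤ a)
    (ha1 : a ≤ 1) :
    |∑ t ∈ Finset.range T, (if digit (ruler t) a then (1 : ℝ) else 0) - T * a| ≤ L := by
  induction L generalizing T a with
  | zero =>
    obtain rfl : T = 0 := by simpa using hT
    simp
  | succ L ih =>
    -- Even times read the leading digit `d`; odd times repeat the construction for the shifted
    -- number `2 * a - d`. Complete pairs add no error, and one unpaired time adds `|d - a| ≤ 1`.
    set d : ℝ := if 1 / 2 ≤ a then 1 else 0 with hd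
    have hd01 : 0 ≤ 2 * a - d ∧ 2 * a - d ≤ 1 ∧ |d - a| ≤ 1 := by
      rw [abs_le]
      split_ifs at hd <;> refine ⟨?_, ?_, ?_, ?_⟩ <;> rw [hd] <;> linarith
    have heven (U : ℕ) (hU : U < 2 ^ L) :
        |∑ t ∈ Finset.range (U * 2), (if digit (ruler t) a then (1 : ℝ) else 0)
          - (U * 2 : ℕ) * a| ≤ L := by
      have hterm (t : ℕ) : ∑ j ∈ Finset.range 2,
          (if digit (ruler (t * 2 + j)) a then (1 : ℝ) else 0)
            = d + if digit (ruler t) (2 * a - d) then (1 : ℝ) else 0 := by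
        rw [Finset.sum_range_succ, Finset.sum_range_one, add_zero, ruler_even, ruler_odd]
        simp [digit, hd]
      rw [sum_range_mul_blocks, Finset.sum_congr rfl fun t _ => hterm t,
        Finset.sum_add_distrib]
      have := ih hU hd01.1 hd01.2.1
      convert this using 2
      simp
      ring
    rw [pow_succ] at hT
    rcases Nat.even_or_odd' T with ⟨U, rfl | rfl⟩
    · have := heven U (by omega)
      rw [mul_comm 2 U]
      push_cast at this ⊢
      linarith
    · have := heven U (by omega)
      rw [mul_comm 2 U, Finset.sum_range_succ, ruler_even]
      have hd' : (if digit 0 a = true then (1 : ℝ) else 0) = d := by simp [digit, hd]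
      rw [hd']
      have h1 := hd01.2.2
      rw [abs_le] at this h1 ⊢
      push_cast at this ⊢
      constructor <;> linarith

/-! ### Upper bounds from self-delimiting descriptions -/

/-- A self-delimiting code of a string followed by a plain string. -/
def selfDelim (w r : BinStr) : BinStr :=
  w.flatMap (fun b => [true, b]) ++ false :: r

theorem length_selfDelim (w r : BinStr) : (selfDelim w r).length = r.length + 2 * w.length + 1 := by
  induction w with
  | nil => simp [selfDelim]
  | cons b w ih =>
    simp only [selfDelim, List.flatMap_cons, List.append_assoc, List.length_append,
      List.length_cons, List.length_nil] at ih ⊢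
    omega

theorem selfDelim_prefix {w r w' r' : BinStr} (h : selfDelim w r <+: selfDelim w' r') :
    w = w' ∧ r <+: r' := by
  induction w generalizing w' with
  | nil =>
    cases w' with
    | nil => simpa [selfDelim] using h
    | cons b w' => simp [selfDelim] at h
  | cons b w ih =>
    cases w' with
    | nil => simp [selfDelim] at h
    | cons b' w' =>
      have h' : b = b' ∧ selfDelim w r <+: selfDelim w' r' := by
        simpa [selfDelim, List.cons_prefix_cons] using h
      obtain ⟨h1, h2⟩ := ih h'.2
      exact ⟨by rw [h'.1, h1], h2⟩

theorem primrec_selfDelim : Primrec₂ selfDelim := by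
  have h : Primrec₂ fun (_ : BinStr × BinStr) (b : Bool) => [true, b] :=
    Primrec.list_cons.comp (Primrec.const true)
      (Primrec.list_cons.comp Primrec.snd (Primrec.const []))
  exact Primrec.list_append.comp (Primrec.list_flatMap Primrec.fst h)
    (Primrec.list_cons.comp (Primrec.const false) Primrec.snd)

theorem condK_le {U : BinStr → BinStr →. BinStr} {p x y : BinStr} (h : x ∈ U p y) :
    condK U x y ≤ p.length :=
  Nat.sInf_le ⟨p, rfl, h⟩

/-- If `g w r y` is computable and the length of `r` can be computed from `w` and `y`, then
`g w r y` can be described given `y` by `r` and a self-delimiting code of `w`. -/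
theorem IsOptimalPrefixMachine.condK_le_of_computable {U : BinStr → BinStr →. BinStr}
    (hU : IsOptimalPrefixMachine U) {cnt : BinStr → BinStr → ℕ}
    {g : BinStr × BinStr → BinStr → BinStr} (hcnt : Computable₂ cnt) (hg : Computable₂ g) :
    ∃ k : ℕ, ∀ w r y : BinStr, r.length = cnt w y →
      condK U (g (w, r) y) y ≤ r.length + 2 * w.length + k := by
  -- The machine searches for the parse of its program. Only `w` pays for self-delimitation; the
  -- length test makes the domain prefix-free at no cost in `r`.
  let F : BinStr × BinStr → ℕ → Option BinStr := fun py n =>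
    (Encodable.decode (α := BinStr × BinStr) n).bind fun wr =>
      if selfDelim wr.1 wr.2 = py.1 ∧ wr.2.length = cnt wr.1 py.2 then some (g wr py.2) else none
  have hF : ∀ py n x, x ∈ F py n ↔ ∃ w r, Encodable.decode n = some (w, r) ∧
      selfDelim w r = py.1 ∧ r.length = cnt w py.2 ∧ g (w, r) py.2 = x := by
    intro py n x
    simp only [F, Option.mem_def, Option.bind_eq_some_iff, Option.ite_none_right_eq_some,
      Option.some.injEq, Prod.exists, and_assoc]
  have hFc : Computable₂ F := by
    refine Computable.option_bind (Computable.decode.comp Computable.snd) ?_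
    have hwr : Computable fun z : ((BinStr × BinStr) × ℕ) × (BinStr × BinStr) => z.2 :=
      Computable.snd
    have hp : Computable fun z : ((BinStr × BinStr) × ℕ) × (BinStr × BinStr) => z.1.1.1 :=
      (Primrec.fst.comp (Primrec.fst.comp Primrec.fst)).to_comp
    have hy : Computable fun z : ((BinStr × BinStr) × ℕ) × (BinStr × BinStr) => z.1.1.2 :=
      (Primrec.snd.comp (Primrec.fst.comp Primrec.fst)).to_comp
    have h1 : Computable fun z : ((BinStr × BinStr) × ℕ) × (BinStr × BinStr) =>
        decide (selfDelim z.2.1 z.2.2 = z.1.1.1) :=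
      (Primrec.eq (α := BinStr)).decide.to_comp.comp
        (primrec_selfDelim.to_comp.comp (Computable.fst.comp hwr) (Computable.snd.comp hwr)) hp
    have h2 : Computable fun z : ((BinStr × BinStr) × ℕ) × (BinStr × BinStr) =>
        decide (z.2.2.length = cnt z.2.1 z.1.1.2) :=
      (Primrec.eq (α := ℕ)).decide.to_comp.comp
        (Computable.list_length.comp (Computable.snd.comp hwr))
        (hcnt.comp (Computable.fst.comp hwr) hy)
    have h3 := Computable.cond (Primrec.and.to_comp.comp h1 h2)
      (Computable.option_some.comp (hg.comp hwr hy)) (Computable.const none)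
    refine h3.of_eq fun z => ?_
    simp [Bool.cond_eq_ite]
  have hM : IsPrefixMachine fun p y => Nat.rfindOpt (F (p, y)) := by
    refine ⟨Partrec.rfindOpt hFc, fun y p q hp hq hpq => ?_⟩
    obtain ⟨n, x, hx⟩ := Nat.rfindOpt_dom.1 hp
    obtain ⟨n', x', hx'⟩ := Nat.rfindOpt_dom.1 hq
    obtain ⟨w, r, -, rfl, hr, -⟩ := (hF _ _ _).1 hx
    obtain ⟨w', r', -, rfl, hr', -⟩ := (hF _ _ _).1 hx'
    obtain ⟨rfl, h⟩ := selfDelim_prefix hpq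
    rw [h.eq_of_length (hr.trans hr'.symm)]
  obtain ⟨k, hk⟩ := hU.optimal _ hM
  refine ⟨k + 1, fun w r y hr => ?_⟩
  have hmem : g (w, r) y ∈ Nat.rfindOpt (F (selfDelim w r, y)) := by
    have hdom : (Nat.rfindOpt (F (selfDelim w r, y))).Dom :=
      Nat.rfindOpt_dom.2 ⟨Encodable.encode (w, r), _,
        (hF _ _ _).2 ⟨w, r, Encodable.encodek _, rfl, hr, rfl⟩⟩
    obtain ⟨n, hn⟩ := Nat.rfindOpt_spec (Part.get_mem hdom)
    obtain ⟨w', r', -, h1, -, h3⟩ := (hF _ _ _).1 hn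
    dsimp only at h1
    obtain ⟨rfl, -⟩ := selfDelim_prefix (show selfDelim w' r' <+: selfDelim w r by rw [h1])
    obtain rfl : r' = r := by simpa [selfDelim] using h1
    simp only at h3
    rw [h3]
    exact Part.get_mem hdom
  obtain ⟨q, hq, hlen⟩ := hk _ _ _ hmem
  rw [length_selfDelim] at hlen
  exact (condK_le hq).trans (by omega)

/-! ### Masks and incompressibility -/

/-- The sequence `ω` with the entries outside of `P` replaced by `false`. -/
def mask (P ω : ℕ → Bool) (i : ℕ) : Bool := P i && ω i

/-- The number of positions below `n` that are visible through `P` but not through `Q`. -/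
def newPositions (P Q : ℕ → Bool) (n : ℕ) : Finset ℕ := {i ∈ Finset.range n | P i && !Q i}

theorem initSeg_eq_iff {w w' : ℕ → Bool} {n : ℕ} :
    initSeg w n = initSeg w' n ↔ ∀ i < n, w i = w' i := by
  rw [initSeg, initSeg, List.ofFn_inj, funext_iff, Fin.forall_iff]

theorem card_length_lt_le (l : ℕ) (s : Finset BinStr) (hs : ∀ p ∈ s, p.length < l) :
    s.card ≤ 2 ^ l := by
  have hsub : s ⊆ (Finset.range l).biUnion fun n =>
      (Finset.univ : Finset (List.Vector Bool n)).image List.Vector.toList := by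
    intro p hp
    simp only [Finset.mem_biUnion, Finset.mem_range, Finset.mem_image, Finset.mem_univ, true_and]
    exact ⟨p.length, hs p hp, ⟨p, rfl⟩, rfl⟩
  refine (Finset.card_le_card hsub).trans (Finset.card_biUnion_le.trans ?_)
  refine (Finset.sum_le_sum (g := fun n => 2 ^ n) fun n _ => ?_).trans ?_
  · exact Finset.card_image_le.trans (by simp [card_vector])
  · rw [Nat.geomSum_eq le_rfl]
    simp

/-- At most `2 ^ l` objects have complexity below `l`. -/
theorem IsOptimalPrefixMachine.card_condK_lt_le {U : BinStr → BinStr →. BinStr}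
    (hU : IsOptimalPrefixMachine U) {κ : Type*} (s : Finset κ) (X : κ → BinStr)
    (hX : Set.InjOn X s) (y : BinStr) (l : ℕ) (hl : ∀ a ∈ s, condK U (X a) y < l) :
    s.card ≤ 2 ^ l := by
  have hp (x : BinStr) : ∃ p : BinStr, p.length = condK U x y ∧ x ∈ U p y := by
    obtain ⟨p, hp⟩ := hU.exists_program x y
    exact Nat.sInf_mem (s := {n : ℕ | ∃ p : BinStr, p.length = n ∧ x ∈ U p y}) ⟨_, p, rfl, hp⟩
  choose p hlen hmem using hp
  classical
  rw [← Finset.card_image_of_injOn (f := fun a => p (X a))]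
  · refine card_length_lt_le l _ fun q hq => ?_
    obtain ⟨a, ha, rfl⟩ := Finset.mem_image.1 hq
    rw [hlen]
    exact hl a ha
  · intro a ha b hb hab
    refine hX ha hb (Part.mem_unique (hmem (X a)) ?_)
    simp only at hab
    rw [hab]
    exact hmem (X b)

/-- The bit sequence of an element of the Cantor group. -/
def bits (z : ℕ → ZMod 2) (i : ℕ) : Bool := decide (z i = 1)

theorem bits_eq_iff {z z' : ℕ → ZMod 2} {i : ℕ} : bits z i = bits z' i ↔ z i = z' i := by
  have : ∀ a b : ZMod 2, decide (a = 1) = decide (b = 1) ↔ a = b := by decide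
  exact this _ _

theorem measurable_initSeg_mask (P : ℕ → Bool) (n : ℕ) :
    @Measurable _ _ _ ⊤ fun z => initSeg (mask P (bits z)) n := by
  let _ : MeasurableSpace BinStr := ⊤
  have h1 : Measurable fun (z : ℕ → ZMod 2) (i : Fin n) => z i :=
    measurable_pi_lambda _ fun i => measurable_pi_apply _
  have h2 : Measurable fun z : Fin n → ZMod 2 =>
      (List.ofFn fun i : Fin n => P i && decide (z i = 1) : BinStr) :=
    measurable_of_finite _
  exact h2.comp h1

/-- Flipping bits at the new positions leaves the condition unchanged and gives distinct outputs, so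
at most `2 ^ l` of the flips of any `z` are bad. Integrating this count and using translation
invariance gives the bound. -/
theorem two_pow_mul_measure_condK_lt_le {U : BinStr → BinStr →. BinStr}
    (hU : IsOptimalPrefixMachine U) (P Q : ℕ → Bool) (n l : ℕ) (μ : Measure (ℕ → ZMod 2))
    [μ.IsAddLeftInvariant] :
    2 ^ (newPositions P Q n).card *
      μ {z | condK U (initSeg (mask P (bits z)) n) (initSeg (mask Q (bits z)) n) < l}
        ≤ 2 ^ l * μ Set.univ := by
  classical
  set D := newPositions P Q n with hD
  set bad := {z | condK U (initSeg (mask P (bits z)) n) (initSeg (mask Q (bits z)) n) < l}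
    with hbad
  have hmeas : MeasurableSet bad := by
    let _ : MeasurableSpace BinStr := ⊤
    have h := (measurable_initSeg_mask P n).prodMk (measurable_initSeg_mask Q n)
    exact h (Set.to_countable {xy : BinStr × BinStr | condK U xy.1 xy.2 < l}).measurableSet
  let e : Finset ℕ → ℕ → ZMod 2 := fun F i => if i ∈ F then 1 else 0
  have hcount (z : ℕ → ZMod 2) :
      (D.powerset.filter fun F => e F + z ∈ bad).card ≤ 2 ^ l := by
    refine hU.card_condK_lt_le _ (fun F => initSeg (mask P (bits (e F + z))) n) ?_
      (initSeg (mask Q (bits z)) n) l ?_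
    · intro F hF G hG hFG
      simp only [Finset.coe_filter, Finset.mem_powerset, Set.mem_ofPred_eq] at hF hG
      ext i
      by_cases hi : i ∈ D
      · have hi' := hi
        simp only [hD, newPositions, Finset.mem_filter, Finset.mem_range, Bool.and_eq_true] at hi'
        have h := initSeg_eq_iff.1 hFG i hi'.1
        simp only [mask, hi'.2.1, Bool.true_and, bits_eq_iff, Pi.add_apply, add_left_inj, e] at h
        by_cases h1 : i ∈ F <;> by_cases h2 : i ∈ G <;> simp [h1, h2] at h ⊢
      · exact iff_of_false (fun h => hi (hF.1 h)) (fun h => hi (hG.1 h))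
    · intro F hF
      simp only [Finset.mem_filter, Finset.mem_powerset, hbad, Set.mem_ofPred_eq] at hF
      have : initSeg (mask Q (bits z)) n = initSeg (mask Q (bits (e F + z))) n := by
        refine initSeg_eq_iff.2 fun i hi => ?_
        by_cases hiF : i ∈ F
        · have := hF.1 hiF
          simp only [hD, newPositions, Finset.mem_filter, Bool.and_eq_true, Bool.not_eq_true'] at this
          simp [mask, this.2.2]
        · simp [mask, bits, e, hiF]
      rw [this]
      exact hF.2
  calc 2 ^ D.card * μ bad
      = ∑ F ∈ D.powerset, ∫⁻ z, bad.indicator 1 (e F + z) ∂μ := by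
        simp_rw [lintegral_add_left_eq_self, lintegral_indicator_one hmeas]
        simp
    _ = ∫⁻ z, ∑ F ∈ D.powerset, bad.indicator 1 (e F + z) ∂μ :=
        (lintegral_finsetSum _ fun F _ =>
          (measurable_one.indicator hmeas).comp (measurable_const_add _)).symm
    _ ≤ ∫⁻ _, 2 ^ l ∂μ := by
        refine lintegral_mono fun z => ?_
        refine le_trans (le_of_eq ?_) ((Nat.cast_le (α := ENNReal)).2 (hcount z) |>.trans_eq
          (by push_cast; rfl))
        rw [Finset.card_filter]
        push_cast
        exact Finset.sum_congr rfl fun F _ => by rw [Set.indicator_apply, Pi.one_apply]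
    _ = 2 ^ l * μ Set.univ := lintegral_const _

/-- A random sequence is incompressible, simultaneously through all pairs of a finite family of
masks. -/
theorem IsOptimalPrefixMachine.exists_incompressible {U : BinStr → BinStr →. BinStr}
    (hU : IsOptimalPrefixMachine U) {κ : Type*} [Finite κ] (P : κ → ℕ → Bool) (n : ℕ → ℕ) :
    ∃ ω : ℕ → Bool, ∀ u v : κ, ∃ B : ℕ, ∀ s : ℕ,
      (newPositions (P u) (P v) (n s)).card ≤
        condK U (initSeg (mask (P u) ω) (n s)) (initSeg (mask (P v) ω) (n s))
          + 2 * Nat.size s + B := by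
  let μ : Measure (ℕ → ZMod 2) := Measure.addHaar
  let bad (u v : κ) (s : ℕ) : Set (ℕ → ZMod 2) :=
    {z | condK U (initSeg (mask (P u) (bits z)) (n s)) (initSeg (mask (P v) (bits z)) (n s))
      < (newPositions (P u) (P v) (n s)).card - 2 * Nat.size s}
  have hle (u v : κ) (s : ℕ) :
      -- The margin `2 * Nat.size s` makes these bounds summable, since `s + 1 ≤ 2 ^ Nat.size s`.
      -- When it exceeds the number of new positions, truncated subtraction makes the threshold `0`
      -- and the bad set empty.
      μ (bad u v s) ≤ ENNReal.ofReal (1 / ((s : ℝ) + 1) ^ 2) * μ Set.univ := by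
    set m := (newPositions (P u) (P v) (n s)).card with hm
    have h := two_pow_mul_measure_condK_lt_le hU (P u) (P v) (n s) (m - 2 * Nat.size s) μ
    rw [← hm] at h
    rcases le_or_gt (2 * Nat.size s) m with hsm | hsm
    · have hfin : μ (bad u v s) ≠ ⊤ := measure_ne_top _ _
      have hfin' : μ Set.univ ≠ ⊤ := measure_ne_top _ _
      have h' := ENNReal.toReal_mono (by finiteness) h
      rw [ENNReal.toReal_mul, ENNReal.toReal_mul] at h'
      simp only [ENNReal.toReal_pow, ENNReal.toReal_ofNat] at h'
      rw [← ENNReal.toReal_le_toReal hfin (by finiteness), ENNReal.toReal_mul,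
        ENNReal.toReal_ofReal (by positivity)]
      have hs : (s : ℝ) + 1 ≤ 2 ^ Nat.size s := by exact_mod_cast Nat.lt_size_self s
      have hs2 : ((s : ℝ) + 1) ^ 2 ≤ 2 ^ (2 * Nat.size s) := by
        rw [mul_comm, pow_mul]
        gcongr
      have hpow : (2 : ℝ) ^ m = 2 ^ (m - 2 * Nat.size s) * 2 ^ (2 * Nat.size s) := by
        rw [← pow_add, Nat.sub_add_cancel hsm]
      rw [hpow, mul_assoc] at h'
      have h2 := le_of_mul_le_mul_left h' (by positivity)
      rw [one_div, inv_mul_eq_div, le_div_iff₀ (by positivity), mul_comm]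
      exact (mul_le_mul_of_nonneg_right hs2 ENNReal.toReal_nonneg).trans h2
    · have : bad u v s = ∅ := by
        ext z
        simp [bad, ← hm, Nat.sub_eq_zero_of_le hsm.le]
      simp [this]
  have hae : ∀ᵐ z ∂μ, ∀ u v : κ, ∀ᶠ s in Filter.atTop, z ∉ bad u v s := by
    refine ae_all_iff.2 fun u => ae_all_iff.2 fun v => ae_eventually_notMem ?_
    refine ne_top_of_le_ne_top ?_ (ENNReal.tsum_le_tsum (hle u v))
    rw [ENNReal.tsum_mul_right]
    refine ENNReal.mul_ne_top (Summable.tsum_ofReal_ne_top ?_) (measure_ne_top _ _)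
    have := (summable_nat_add_iff 1).2 (Real.summable_one_div_nat_pow.2 one_lt_two)
    simpa using this
  obtain ⟨z, hz⟩ := hae.exists
  refine ⟨bits z, fun u v => ?_⟩
  obtain ⟨s₀, hs₀⟩ := Filter.eventually_atTop.1 (hz u v)
  -- The finitely many exceptional `s` are absorbed in the constant.
  refine ⟨∑ s ∈ Finset.range s₀, (newPositions (P u) (P v) (n s)).card, fun s => ?_⟩
  rcases lt_or_ge s s₀ with h | h
  · have := Finset.single_le_sum (f := fun s => (newPositions (P u) (P v) (n s)).card)
      (fun _ _ => Nat.zero_le _) (Finset.mem_range.2 h)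
    omega
  · have := hs₀ s h
    simp only [bad, Set.mem_ofPred_eq, not_lt] at this
    omega

/-! ### Masks computable from few digits -/

/-- The index of the digit that decides whether position `i` carries information, when `J`
cuts take turns. -/
def digitIndex (J i : ℕ) : ℕ := ruler (i / J) * J + i % J

/-- The positions selected by the digit table `b` in those turns that the table `A` allows. -/
def turnMask (J : ℕ) (b : ℕ → Bool) (A : List Bool) (i : ℕ) : Bool :=
  b (digitIndex J i) && A.getD (i % J) false

/-- The positions visible through `A` but not through `B`, for a finite digit table `w`. -/
def isNew (J : ℕ) (A B : List Bool) (w : BinStr) (i : ℕ) : Bool :=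
  w.getD (digitIndex J i) false && (A.getD (i % J) false && !B.getD (i % J) false)

theorem primrec_digitIndex (J : ℕ) : Primrec (digitIndex J) :=
  Primrec.nat_add.comp
    (Primrec.nat_mul.comp
      (primrec_ruler.comp (Primrec.nat_div.comp Primrec.id (Primrec.const J))) (Primrec.const J))
    (Primrec.nat_mod.comp Primrec.id (Primrec.const J))

theorem primrec_getD_mod (J : ℕ) (A : List Bool) : Primrec fun i : ℕ => A.getD (i % J) false :=
  (Primrec.list_getD false).comp (Primrec.const A)
    (Primrec.nat_mod.comp Primrec.id (Primrec.const J))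

theorem primrec_isNew (J : ℕ) (A B : List Bool) : Primrec₂ (isNew J A B) :=
  Primrec.and.comp
    ((Primrec.list_getD false).comp Primrec.fst ((primrec_digitIndex J).comp Primrec.snd))
    (Primrec.and.comp ((primrec_getD_mod J A).comp Primrec.snd)
      (Primrec.not.comp ((primrec_getD_mod J B).comp Primrec.snd)))

theorem primrec_filter_isNew (J : ℕ) (A B : List Bool) :
    Primrec₂ fun (w : BinStr) (n : ℕ) => (List.range n).filter (isNew J A B w) := by
  have hrel : PrimrecRel fun (i : ℕ) (w : BinStr) => isNew J A B w i = true :=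
    Primrec.eq.comp ((primrec_isNew J A B).comp Primrec.snd Primrec.fst) (Primrec.const true)
  exact (hrel.listFilter.comp (Primrec.list_range.comp Primrec.snd) Primrec.fst).of_eq
    fun z => by simp

theorem getD_initSeg {w : ℕ → Bool} {n i : ℕ} (h : i < n) : (initSeg w n).getD i false = w i := by
  simp [initSeg, List.getD_eq_getElem?_getD, h]

/-- The number of selected positions before `i` is the index of the bit of `i` in the compressed
list, so this lemma decodes it. -/
theorem getD_filter_range_map (p ω : ℕ → Bool) {n i : ℕ} (hi : i < n) (hp : p i = true) :
    (((List.range n).filter p).map ω).getD ((List.range i).filter p).length false = ω i := by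
  obtain ⟨k, rfl⟩ := Nat.exists_eq_add_of_lt hi
  rw [show i + k + 1 = i + 1 + k by ring, List.range_add, List.range_succ]
  simp [List.filter_append, hp, List.getD_eq_getElem?_getD]

theorem IsOptimalPrefixMachine.exists_condK_turnMask_le {U : BinStr → BinStr →. BinStr}
    (hU : IsOptimalPrefixMachine U) (J : ℕ) (A B : List Bool) :
    ∃ k : ℕ, ∀ (b ω : ℕ → Bool) (n l : ℕ), (∀ i < n, digitIndex J i < l) →
      condK U (initSeg (mask (turnMask J b A) ω) n) (initSeg (mask (turnMask J b B) ω) n)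
        ≤ (newPositions (turnMask J b A) (turnMask J b B) n).card + 2 * l + k := by
  let cnt : BinStr → BinStr → ℕ := fun w y =>
    ((List.range y.length).filter (isNew J A B w)).length
  -- New bits are read from `r`. At any other position that `A` allows, either the digit is `0` and
  -- both views show `false`, or `B` also sees the bit and it is copied from `y`.
  let g : BinStr × BinStr → BinStr → BinStr := fun wr y =>
    (List.range y.length).map fun i =>
      bif isNew J A B wr.1 i then wr.2.getD ((List.range i).filter (isNew J A B wr.1)).length false
      else A.getD (i % J) false && y.getD i false
  have hcnt : Primrec₂ cnt := Primrec.list_length.comp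
    ((primrec_filter_isNew J A B).comp Primrec.fst (Primrec.list_length.comp Primrec.snd))
  have hg : Primrec₂ g := by
    refine Primrec.list_map (Primrec.list_range.comp (Primrec.list_length.comp Primrec.snd)) ?_
    have hi : Primrec fun z : ((BinStr × BinStr) × BinStr) × ℕ => z.2 := Primrec.snd
    have hy : Primrec fun z : ((BinStr × BinStr) × BinStr) × ℕ => z.1.2 :=
      Primrec.snd.comp Primrec.fst
    have hr : Primrec fun z : ((BinStr × BinStr) × BinStr) × ℕ => z.1.1.2 :=
      Primrec.snd.comp (Primrec.fst.comp Primrec.fst)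
    have hw : Primrec fun z : ((BinStr × BinStr) × BinStr) × ℕ => z.1.1.1 :=
      Primrec.fst.comp (Primrec.fst.comp Primrec.fst)
    exact Primrec.cond ((primrec_isNew J A B).comp hw hi)
      ((Primrec.list_getD false).comp hr
        (Primrec.list_length.comp ((primrec_filter_isNew J A B).comp hw hi)))
      (Primrec.and.comp ((primrec_getD_mod J A).comp hi) ((Primrec.list_getD false).comp hy hi))
  obtain ⟨k, hk⟩ := hU.condK_le_of_computable hcnt.to_comp hg.to_comp
  refine ⟨k, fun b ω n l hl => ?_⟩
  set x := initSeg (mask (turnMask J b A) ω) n with hx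
  set y := initSeg (mask (turnMask J b B) ω) n with hy
  set w := initSeg b l with hw
  set r : BinStr := ((List.range n).filter (isNew J A B w)).map ω with hr
  have hylen : y.length = n := by simp [hy, initSeg]
  have hnew : ∀ i < n, isNew J A B w i = (turnMask J b A i && !turnMask J b B i) := by
    intro i hi
    rw [isNew, hw, getD_initSeg (hl i hi), turnMask, turnMask]
    cases b (digitIndex J i) <;> simp
  have hrlen : r.length = (newPositions (turnMask J b A) (turnMask J b B) n).card := by
    rw [hr, List.length_map, newPositions]
    have : (List.range n).filter (isNew J A B w) =
        (List.range n).filter fun i => turnMask J b A i && !turnMask J b B i :=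
      List.filter_congr fun i hi => hnew i (List.mem_range.1 hi)
    rw [this, ← List.toFinset_card_of_nodup (List.nodup_range.filter _)]
    congr 1
    ext i
    simp
  have hgx : g (w, r) y = x := by
    refine List.ext_getElem (by simp [g, hylen, hx, initSeg]) fun i h1 h2 => ?_
    have hi : i < n := by simpa [hx, initSeg] using h2
    have hyi : y.getD i false = mask (turnMask J b B) ω i := by rw [hy, getD_initSeg hi]
    simp only [g, List.getElem_map, List.getElem_range, hx, initSeg, List.getElem_ofFn, hyi]
    cases hn : isNew J A B w i with
    | true =>
      rw [cond_true, hr, getD_filter_range_map _ ω hi hn]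
      rw [hnew i hi, Bool.and_eq_true] at hn
      simp [mask, hn.1]
    | false =>
      rw [hnew i hi] at hn
      simp only [mask, turnMask, cond_false] at hn ⊢
      revert hn
      cases b (digitIndex J i) <;> cases A.getD (i % J) false <;> cases B.getD (i % J) false <;>
        simp
  have h := hk w r y (by rw [hrlen]; simp only [cnt, hylen]; rw [← hrlen, hr, List.length_map])
  rw [hgx, hrlen] at h
  simpa [hw, initSeg] using h

/-- The digit table in which the digits of the `J` numbers `a 0, …, a (J - 1)` alternate. -/
noncomputable def digitTable (J : ℕ) (a : ℕ → ℝ) (k : ℕ) : Bool := digit (k / J) (a (k % J))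

/-- This is why arbitrary real weights cost only logarithmically many bits: `T` turns consult only
the first `L` digits of each of the `J` numbers. -/
theorem digitIndex_lt {J T L i : ℕ} (hT : T < 2 ^ L) (hi : i < T * J) : digitIndex J i < L * J := by
  have hJ : 0 < J := Nat.pos_of_ne_zero fun h => by simp [h] at hi
  have h1 : i / J < T := (Nat.div_lt_iff_lt_mul hJ).2 hi
  have h2 : ruler (i / J) + 1 ≤ L := ruler_lt (lt_of_le_of_lt h1 hT)
  have h3 := Nat.mul_le_mul_right J h2
  rw [add_mul, one_mul] at h3
  exact lt_of_lt_of_le (Nat.add_lt_add_left (Nat.mod_lt i hJ) _) h3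

theorem abs_card_newPositions_sub_le (J : ℕ) (A B : List Bool) {a : ℕ → ℝ} (ha0 : ∀ j, 0 ≤ a j)
    (ha1 : ∀ j, a j ≤ 1) {T L : ℕ} (hT : T < 2 ^ L) :
    |((newPositions (turnMask J (digitTable J a) A) (turnMask J (digitTable J a) B)
        (T * J)).card : ℝ)
      - T * ∑ j ∈ Finset.range J, (if A.getD j false && !B.getD j false then a j else 0)|
      ≤ J * L := by
  have hblock (t j : ℕ) (hj : j < J) :
      (if (turnMask J (digitTable J a) A (t * J + j) &&
          !turnMask J (digitTable J a) B (t * J + j)) = true then (1 : ℝ) else 0)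
        = if A.getD j false && !B.getD j false then
            (if digit (ruler t) (a j) then (1 : ℝ) else 0) else 0 := by
    have hJ : 0 < J := by omega
    have hdiv (u : ℕ) : (u * J + j) / J = u := by
      rw [mul_comm, Nat.mul_add_div hJ, Nat.div_eq_of_lt hj, add_zero]
    have hmod (u : ℕ) : (u * J + j) % J = j := by
      rw [mul_comm, Nat.mul_add_mod, Nat.mod_eq_of_lt hj]
    simp only [turnMask, digitTable, digitIndex, hdiv, hmod]
    cases digit (ruler t) (a j) <;> simp
  rw [newPositions, Finset.card_filter]
  push_cast
  rw [sum_range_mul_blocks, Finset.sum_comm, Finset.mul_sum, ← Finset.sum_sub_distrib]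
  refine (Finset.abs_sum_le_sum_abs _ _).trans ?_
  refine (Finset.sum_le_sum (g := fun _ => (L : ℝ)) fun j hj => ?_).trans_eq (by simp)
  rw [Finset.sum_congr rfl fun t _ => hblock t j (Finset.mem_range.1 hj)]
  split_ifs with h
  · exact abs_sum_digit_ruler_sub_le L hT (ha0 j) (ha1 j)
  · simp

theorem natSize_le_logb {m : ℕ} (hm : 1 ≤ m) : (Nat.size m : ℝ) ≤ Real.logb 2 m + 1 := by
  have h0 : 0 < Nat.size m := Nat.size_pos.2 hm
  have h1 : 2 ^ (Nat.size m - 1) ≤ m := Nat.lt_size.1 (by omega)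
  have h2 : ((Nat.size m - 1 : ℕ) : ℝ) ≤ Real.logb 2 m := by
    rw [Real.le_logb_iff_rpow_le one_lt_two (by exact_mod_cast hm), Real.rpow_natCast]
    exact_mod_cast h1
  have h3 : (Nat.size m : ℝ) = ((Nat.size m - 1 : ℕ) : ℝ) + 1 := by
    rw [← Nat.cast_add_one, Nat.sub_add_cancel h0]
  linarith

/-! ### Assembly of the embedding -/

/-- The complexities themselves satisfy the estimate required of a sequence embedding, if all
distances are cut distances. -/
theorem IsOptimalPrefixMachine.exists_condK_embedding {U : BinStr → BinStr →. BinStr}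
    (hU : IsOptimalPrefixMachine U) {ι : Type*} [Fintype ι] [DecidableEq ι] (d : ι → ι → ℝ)
    (lam : Finset ι → ℝ) (hlam : ∀ S, 0 ≤ lam S)
    (hd : ∀ i j, ∑ S with i ∈ S ∧ j ∉ S, lam S = d i j) :
    ∃ (φ : ι → ℕ → Bool) (N : ℕ), 1 ≤ N ∧ ∃ a b : ℝ, 0 ≤ a ∧ ∀ (s : ℕ) (u v : ι), 1 ≤ s →
      |(condK U (initSeg (φ u) (N * s)) (initSeg (φ v) (N * s)) : ℝ) - s * d u v|
        ≤ a * Real.logb 2 s + b := by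
  set J := Fintype.card (Finset ι) with hJ
  have hJpos : 0 < J := Fintype.card_pos
  let e : Finset ι ≃ Fin J := Fintype.equivFin _
  -- Division by `R` makes the weights densities in `[0, 1]`; using `R * s` turns at scale `s`
  -- compensates for it.
  obtain ⟨R, hR1, hR⟩ : ∃ R : ℕ, 1 ≤ R ∧ ∀ S, lam S ≤ R := by
    obtain ⟨R, hR⟩ := exists_nat_ge (∑ S, lam S)
    refine ⟨R + 1, by omega, fun S => ?_⟩
    have := Finset.single_le_sum (fun S _ => hlam S) (Finset.mem_univ S)
    push_cast
    linarith
  have hRpos : (0 : ℝ) < R := by exact_mod_cast hR1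
  let a : ℕ → ℝ := fun j => if h : j < J then lam (e.symm ⟨j, h⟩) / R else 0
  have ha0 (j : ℕ) : 0 ≤ a j := by
    simp only [a]
    split_ifs
    · exact div_nonneg (hlam _) hRpos.le
    · exact le_rfl
  have ha1 (j : ℕ) : a j ≤ 1 := by
    simp only [a]
    split_ifs
    · exact (div_le_one hRpos).2 (hR _)
    · exact zero_le_one
  let A : ι → List Bool := fun u => List.ofFn fun j : Fin J => decide (u ∈ e.symm j)
  have hA (u v : ι) :
      ∑ j ∈ Finset.range J, (if (A u).getD j false && !(A v).getD j false then a j else 0)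
        = d u v / R := by
    rw [← hd, Finset.sum_filter, Finset.sum_div, ← Equiv.sum_comp e.symm, Finset.sum_range]
    refine Finset.sum_congr rfl fun j _ => ?_
    by_cases hu : u ∈ e.symm j <;> by_cases hv : v ∈ e.symm j <;>
      simp [A, a, List.getD_eq_getElem?_getD, hu, hv]
  let P : ι → ℕ → Bool := fun u => turnMask J (digitTable J a) (A u)
  obtain ⟨ω, hω⟩ := hU.exists_incompressible P fun s => R * s * J
  choose B hB using hω
  choose k hk using fun u v => hU.exists_condK_turnMask_le J (A u) (A v)
  let M : ℕ := ∑ u, ∑ v, (B u v + k u v)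
  have hM (u v : ι) : B u v + k u v ≤ M :=
    (Finset.single_le_sum (f := fun v => B u v + k u v) (fun _ _ => Nat.zero_le _)
      (Finset.mem_univ v)).trans
      (Finset.single_le_sum (f := fun u => ∑ v, (B u v + k u v)) (fun _ _ => Nat.zero_le _)
        (Finset.mem_univ u))
  -- The coefficient covers the density error `J * L`, the digit table `2 * (L * J)` and the
  -- incompressibility margin `2 * L`, with `L` the binary size of `R * s`.
  refine ⟨fun u => mask (P u) ω, R * J, Nat.mul_pos hR1 hJpos, 3 * J + 2,
    (3 * J + 2) * (Real.logb 2 R + 1) + M, by positivity, fun s u v hs => ?_⟩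
  rw [show R * J * s = R * s * J by ring]
  set L := Nat.size (R * s) with hL
  have hT : R * s < 2 ^ L := Nat.lt_size_self _
  have hsL : Nat.size s ≤ L := Nat.size_le_size (Nat.le_mul_of_pos_left s hR1)
  have hLlog : (L : ℝ) ≤ Real.logb 2 s + (Real.logb 2 R + 1) := by
    have h := natSize_le_logb (m := R * s) (Nat.mul_pos hR1 hs)
    rw [Nat.cast_mul, Real.logb_mul hRpos.ne' (by positivity)] at h
    linarith
  have h1 := abs_card_newPositions_sub_le J (A u) (A v) ha0 ha1 hT
  rw [hA, Nat.cast_mul, show (R : ℝ) * s * (d u v / R) = s * d u v by field_simp] at h1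
  have h2 := hB u v s
  have h3 := hk u v (digitTable J a) ω (R * s * J) (L * J) fun i hi => digitIndex_lt hT hi
  have h4 := hM u v
  simp only [P] at h2 ⊢
  set K := condK U (initSeg (mask (turnMask J (digitTable J a) (A u)) ω) (R * s * J))
    (initSeg (mask (turnMask J (digitTable J a) (A v)) ω) (R * s * J))
  set m := (newPositions (turnMask J (digitTable J a) (A u)) (turnMask J (digitTable J a) (A v))
    (R * s * J)).card
  have h2' : (m : ℝ) ≤ K + 2 * L + M := by
    exact_mod_cast (by omega : m ≤ K + 2 * L + M)
  have h3' : (K : ℝ) ≤ m + 2 * (L * J) + M := by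
    exact_mod_cast (by omega : K ≤ m + 2 * (L * J) + M)
  have h5 : (3 * J + 2 : ℝ) * L ≤ (3 * J + 2) * (Real.logb 2 s + (Real.logb 2 R + 1)) :=
    mul_le_mul_of_nonneg_left hLlog (by positivity)
  have h6 : (0 : ℝ) ≤ J * L := by positivity
  have h7 : (0 : ℝ) ≤ L := by positivity
  rw [abs_le] at h1 ⊢
  constructor <;> nlinarith

/-- Only coinciding strings need care, as `δ` is then `0` while `K` need not be. The estimate for
the pair `u, u` bounds `K x x`, so `s * dist u v` is at most twice the error; hence the doubled
constants. -/
theorem sequenceEmbeds_of_complexity_estimate {V : Type*} [MetricSpace V]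
    {δ K : BinStr → BinStr → ℝ} {c : ℝ} (hc : 0 ≤ c) (hδ : ∀ x, δ x x = 0)
    (hδK : ∀ x y, x ≠ y → δ x y = K x y + c) {φ : V → ℕ → Bool} {N : ℕ} (hN : 1 ≤ N) {a b : ℝ}
    (ha : 0 ≤ a)
    (hK : ∀ (s : ℕ) (u v : V), 1 ≤ s →
      |K (initSeg (φ u) (N * s)) (initSeg (φ v) (N * s)) - s * dist u v|
        ≤ a * Real.logb 2 s + b) :
    SequenceEmbeds V δ := by
  refine ⟨φ, fun s _ => N * s, fun _ => strictMono_mul_left_of_pos hN,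
    ⟨N, 1, fun v s _ => by simp⟩, 2 * a, 2 * b + c, fun s u v hs => ?_⟩
  have hlog : 0 ≤ Real.logb 2 s := Real.logb_nonneg one_lt_two (by exact_mod_cast hs)
  have h1 := abs_le.1 (hK s u v hs)
  have h2 := abs_le.1 (hK s u u hs)
  rw [dist_self, mul_zero, sub_zero] at h2
  have h3 : 0 ≤ a * Real.logb 2 s := mul_nonneg ha hlog
  by_cases hxy : initSeg (φ u) (N * s) = initSeg (φ v) (N * s)
  · rw [← hxy] at h1 ⊢
    have h4 : 0 ≤ s * dist u v := by positivity
    rw [hδ, zero_sub, abs_neg, abs_of_nonneg h4]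
    linarith
  · rw [hδK _ _ hxy, abs_le]
    constructor <;> linarith

end AlgDist

theorem mainTheorem4 {E : Type*} [NormedAddCommGroup E] [InnerProductSpace ℝ E]
    (V : Set E) (hV : V.Finite)
    (U : AlgDist.BinStr → AlgDist.BinStr →. AlgDist.BinStr)
    (hU : AlgDist.IsOptimalPrefixMachine U) (c : ℝ) (hc : 0 ≤ c) :
    AlgDist.SequenceEmbeds V (AlgDist.dK U c) ∧
      AlgDist.SequenceEmbeds V (AlgDist.dKAvg U c) := by
  classical
  have : Fintype V := hV.fintype
  -- Lebesgue measure needs finite dimension, so the points are moved into their span.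
  have : FiniteDimensional ℝ (Submodule.span ℝ V) := FiniteDimensional.span_of_finite ℝ hV
  obtain ⟨lam, hlam, hsum⟩ := AlgDist.exists_cut_weights
    fun v : V => (⟨v, Submodule.subset_span v.2⟩ : Submodule.span ℝ V)
  obtain ⟨φ, N, hN, a, b, ha, hK⟩ := hU.exists_condK_embedding (fun u v : V => dist u v) lam hlam
    fun u v => by rw [hsum, Subtype.dist_eq, dist_eq_norm]; rfl
  constructor
  · refine AlgDist.sequenceEmbeds_of_complexity_estimate
      (K := fun x y => max (AlgDist.condK U x y : ℝ) (AlgDist.condK U y x)) (φ := φ) (b := b) hc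
      (fun x => if_pos rfl) (fun x y h => if_neg h) hN ha fun s u v hs => ?_
    have h1 := abs_le.1 (hK s u v hs)
    have h2 := abs_le.1 (hK s v u hs)
    rw [dist_comm] at h2
    rw [abs_le]
    exact ⟨(h1.1).trans (sub_le_sub_right (le_max_left _ _) _),
      sub_le_iff_le_add.2 (max_le (sub_le_iff_le_add.1 h1.2) (sub_le_iff_le_add.1 h2.2))⟩
  · refine AlgDist.sequenceEmbeds_of_complexity_estimate
      (K := fun x y => ((AlgDist.condK U x y : ℝ) + AlgDist.condK U y x) / 2) (φ := φ) (b := b) hc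
      (fun x => if_pos rfl) (fun x y h => if_neg h) hN ha fun s u v hs => ?_
    have h1 := abs_le.1 (hK s u v hs)
    have h2 := abs_le.1 (hK s v u hs)
    rw [dist_comm] at h2
    rw [abs_le]
    constructor <;> linarith
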